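/- Let $R$ be a finite group, identified with its right regular permutation representation (the group of all permutations $x\mapsto xr$ of $R$, $r\in R$), and let $G$ be a (necessarily transitive) permutation group on the set $R$ that properly contains $R$. Let $G_1$ be the stabilizer of $1\in R$ in $G$, let $K=\bigcap_{g\in G}R^g$ be the core of $R$ in $G$, and let $H=G_1K/K\le G/K$, acting on $R/K$ by $(Kx)^{gK}=Kx^g$. Suppose that $H$ does not act trivially on $R/K$ (equivalently, some orbit of $K$ on $R$ is not stabilized by $G_1$), and that $R/K$ is neither abelian of exponent greater than $2$ nor generalized dicyclic; here a group is generalized dicyclic if it is non-abelian and has an abelian normal subgroup $A$ of index $2$ and an element $x\notin A$ of order $4$ such that $x^{-1}ax=a^{-1}$ for all $a\in A$. Let $\mathcal L$ be the set of all subsets $S\subseteq R$ such that $S=S^{-1}$ and, for each $H$-orbit $\Delta$ on $R/K$, the numbers $|S\cap Kx|$ for $Kx\in\Delta$ are all equal. Then $$|\mathcal L|\le 2^{\mathbf c(R)-\frac{1}{96}|R/K|},$$ where $\mathbf c(R)=\frac{1}{2}\bigl(|R|+|\{x\in R: x^2=1\}|\bigr)$. -/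

import Mathlib

open scoped Pointwise

/-! Permutation groups on a group `R` that contain the right regular representation of `R`. -/

namespace RegularOvergroup

/-- The right regular representation of `R`, as a homomorphism into `Sym(R)`: permutations
compose from right to left here, so `r` is sent to the permutation `x ↦ x * r⁻¹`. Its image is
the set of all right multiplications `x ↦ x * r`. -/
def rightRegularHom (R : Type*) [Group R] : R →* Equiv.Perm R where
  toFun r := Equiv.mulRight r⁻¹
  map_one' := by ext x; simp
  map_mul' r s := by ext x; simp [mul_assoc]

/-- The group of all right multiplications `x ↦ x * r`. -/
def rightRegular (R : Type*) [Group R] : Subgroup (Equiv.Perm R) :=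
  (rightRegularHom R).range

theorem mem_rightRegular {R : Type*} [Group R] (g : Equiv.Perm R) :
    g ∈ rightRegular R ↔ ∃ r : R, ∀ x : R, g x = x * r := by
  constructor
  · rintro ⟨r, rfl⟩
    exact ⟨r⁻¹, fun x => rfl⟩
  · rintro ⟨r, hr⟩
    refine ⟨r⁻¹, ?_⟩
    ext x
    simp [rightRegularHom, hr]

section Core

variable {R : Type*} [Group R] (G : Subgroup (Equiv.Perm R)) (hG : rightRegular R ≤ G)

/-- The right regular representation, regarded as a homomorphism into a group `G` of
permutations that contains it. -/
def embed : R →* G :=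
  (rightRegularHom R).codRestrict G fun r => hG ⟨r, rfl⟩

/-- The core of `R` in `G`, the intersection of all `G`-conjugates of (the image of) `R`,
as a subgroup of `G`. -/
def coreInG : Subgroup G :=
  (embed G hG).range.normalCore

/-- The core of `R` in `G`, as a subgroup of `R`. -/
def core : Subgroup R :=
  (coreInG G hG).comap (embed G hG)

instance coreInG_normal : (coreInG G hG).Normal :=
  Subgroup.normalCore_normal _

instance core_normal : (core G hG).Normal :=
  Subgroup.normal_comap _

theorem mk_apply_eq (g : G) (x y : R)
    (h : (QuotientGroup.mk x : R ⧸ core G hG) = QuotientGroup.mk y) :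
    (QuotientGroup.mk (g • x) : R ⧸ core G hG) = QuotientGroup.mk (g • y) := by
  rw [QuotientGroup.eq] at h ⊢
  have h1 : embed G hG (x⁻¹ * y) ∈ coreInG G hG := h
  have h2 := (coreInG_normal G hG).conj_mem _ h1 g
  obtain ⟨k, hk⟩ := (embed G hG).range.normalCore_le h2
  have h3 : k ∈ core G hG := by
    change embed G hG k ∈ coreInG G hG
    rw [hk]
    exact h2
  have h4 : embed G hG k * g = g * embed G hG (x⁻¹ * y) := by
    rw [hk]; group
  have h5 : (g • y) * k⁻¹ = g • x := by
    have h6 := congrArg (fun p : G => p • y) h4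
    simp only [mul_smul] at h6
    have h7 : embed G hG (x⁻¹ * y) • y = x := by
      change y * (x⁻¹ * y)⁻¹ = x
      group
    rw [h7] at h6
    exact h6
  have h8 : (g • x)⁻¹ * (g • y) = k := by
    rw [← h5]; group
  rw [h8]
  exact h3

/-- The natural action of `G` on `R/K`, where `K` is the core: `g` sends the `K`-coset of `x`
to the `K`-coset of the image of `x` under `g`. -/
def quotientPermHom : G →* Equiv.Perm (R ⧸ core G hG) where
  toFun g :=
    { toFun := Quotient.map' (fun x => g • x) fun x y h =>
        Quotient.exact (mk_apply_eq G hG g x y (Quotient.sound h))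
      invFun := Quotient.map' (fun x => g⁻¹ • x) fun x y h =>
        Quotient.exact (mk_apply_eq G hG g⁻¹ x y (Quotient.sound h))
      left_inv := by
        rintro ⟨x⟩
        exact congrArg QuotientGroup.mk (inv_smul_smul g x)
      right_inv := by
        rintro ⟨x⟩
        exact congrArg QuotientGroup.mk (smul_inv_smul g x) }
  map_one' := by
    ext ⟨x⟩
    rfl
  map_mul' g h := by
    ext ⟨x⟩
    rfl

theorem coreInG_le_ker : coreInG G hG ≤ (quotientPermHom G hG).ker := by
  intro g hg
  obtain ⟨k, rfl⟩ := (embed G hG).range.normalCore_le hg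
  have hk : k ∈ core G hG := hg
  rw [MonoidHom.mem_ker]
  ext q
  obtain ⟨x, rfl⟩ := QuotientGroup.mk_surjective q
  change (QuotientGroup.mk (x * k⁻¹) : R ⧸ core G hG) = QuotientGroup.mk x
  rw [QuotientGroup.eq]
  simpa using hk

/-- The natural action of `G/K` on `R/K`. -/
instance quotientAction : MulAction (G ⧸ coreInG G hG) (R ⧸ core G hG) :=
  MulAction.compHom _ (QuotientGroup.lift (coreInG G hG) (quotientPermHom G hG)
    (coreInG_le_ker G hG))

theorem quotient_smul_mk (g : G) (x : R) :
    (QuotientGroup.mk g : G ⧸ coreInG G hG) • (QuotientGroup.mk x : R ⧸ core G hG) =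
      QuotientGroup.mk (g • x) :=
  rfl

/-- The subgroup `H = G₁K/K` of `G/K`, where `G₁` is the stabilizer of `1 ∈ R` in `G`. -/
def stabilizerImage : Subgroup (G ⧸ coreInG G hG) :=
  (MulAction.stabilizer G (1 : R)).map (QuotientGroup.mk' (coreInG G hG))

end Core

/-- Abelian of exponent greater than `2`. -/
def IsAbelianOfExponentGTTwo (R : Type*) [Group R] : Prop :=
  (∀ a b : R, a * b = b * a) ∧ 2 < Monoid.exponent R

/-- Generalized dicyclic groups. -/
def IsGeneralizedDicyclic (R : Type*) [Group R] : Prop :=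
  (¬ ∀ a b : R, a * b = b * a) ∧
    ∃ A : Subgroup R, A.Normal ∧ A.index = 2 ∧ (∀ a ∈ A, ∀ b ∈ A, a * b = b * a) ∧
      ∃ x : R, x ∉ A ∧ orderOf x = 4 ∧ ∀ a ∈ A, x⁻¹ * a * x = a⁻¹

/-- `c(X) = (|X| + |I(X)|) / 2`, where `I(X)` is the set of elements of `X` of order at
most `2`. -/
noncomputable def c {R : Type*} [Group R] (X : Set R) : ℝ :=
  ((X.ncard : ℝ) + ({x ∈ X | x ^ 2 = 1}.ncard : ℝ)) / 2

/-- `S` intersects `Δ`, a union of right `Q`-cosets, evenly: `S` has the same number of elements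
in each of the right `Q`-cosets contained in `Δ`. -/
def IntersectsEvenly {R : Type*} [Group R] (Q : Subgroup R) (S Δ : Set R) : Prop :=
  ∀ x y : R, MulOpposite.op x • (Q : Set R) ⊆ Δ → MulOpposite.op y • (Q : Set R) ⊆ Δ →
    (S ∩ MulOpposite.op x • (Q : Set R)).ncard = (S ∩ MulOpposite.op y • (Q : Set R)).ncard

/-- The inverse-closed subsets `S` of `R` that, for each `H`-orbit on `R/K`, intersect the full
preimage of this orbit in `R` evenly. -/
def evenSets {R : Type*} [Group R] (G : Subgroup (Equiv.Perm R)) (hG : rightRegular R ≤ G) :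
    Set (Set R) :=
  {S | S⁻¹ = S ∧ ∀ q : R ⧸ core G hG,
    IntersectsEvenly (core G hG) S
      ((QuotientGroup.mk : R → R ⧸ core G hG) ⁻¹' MulAction.orbit (stabilizerImage G hG) q)}

end RegularOvergroup

/-! An inverse-closed subset of `R` is determined by its trace on a transversal for inversion, which
has `c(R)` elements, so there are at most `2 ^ c(R)` of them. Evenness costs a positive proportion
of `|R/K|` in the exponent, for two reasons.

Group theory: if all but fewer than 1/24 of the points of `R/K` are fixed or inverted by every
element of `H`, and `H` acts nontrivially, then `R/K` is abelian of exponent greater than 2 or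
generalized dicyclic (`isAbelianOfExponentGTTwo_or_isGeneralizedDicyclic`). The stabilizer identity
`h (y * x) = h' y * h x` turns "fixed or inverted" into word relations valid for almost all pairs,
and counting makes them hold everywhere. So under the hypotheses at least `|R/K|/24` cosets `q` have
an image `h • q` other than `q` and `q⁻¹`.

Counting: every even set has equally many elements in such a `q` and in `h • q`. At least a quarter
of these cosets are "dependent": their count is dictated by a coset with a smaller label. Toggling
one inverse pair of elements in each coset of an arbitrary set of dependent cosets is reversible
(`injOn_symmDiff_toggleSet`), so `|L| * 2 ^ |D| ≤ 2 ^ c(R)` with `|D| ≥ |R/K|/96`. -/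

namespace RegularOvergroup

open scoped symmDiff

/-! ### Pigeonhole and sizes of subgroups -/

section Counting

/-- Union bound. In the uses, `Y` is the exceptional set of points neither fixed nor inverted, `φ`
lists the translates that must avoid it, and `V` is a union of subgroups, cosets or complements. -/
theorem exists_notMem_of_card_lt {α : Type*} [Finite α] {k : ℕ} (Y V : Set α)
    (φ : Fin k → α → α) (hφ : ∀ i, Function.Injective (φ i))
    (h : k * Y.ncard + V.ncard < Nat.card α) : ∃ y, y ∉ V ∧ ∀ i, φ i y ∉ Y := by
  by_contra! hcon
  have hcover : (Set.univ : Set α) ⊆ V ∪ ⋃ i, φ i ⁻¹' Y := by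
    intro y _
    by_cases hy : y ∈ V
    · exact Or.inl hy
    · exact Or.inr (Set.mem_iUnion.2 (hcon y hy))
  have h1 := Set.ncard_le_ncard hcover (Set.toFinite _)
  have h2 := Set.ncard_union_le V (⋃ i, φ i ⁻¹' Y)
  have h3 := Set.ncard_iUnion_le_of_fintype (fun i => φ i ⁻¹' Y)
  have h4 : ∑ i, (φ i ⁻¹' Y).ncard ≤ ∑ _i : Fin k, Y.ncard :=
    Finset.sum_le_sum fun i _ =>
      Set.ncard_le_ncard_of_injOn (φ i) (fun a ha => ha) (hφ i).injOn (Set.toFinite _)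
  rw [Set.ncard_univ] at h1
  simp only [Finset.sum_const, Finset.card_univ, Fintype.card_fin, smul_eq_mul] at h4
  omega

variable {R : Type*} [Group R]

theorem ncard_coe_subgroup (A : Subgroup R) : (A : Set R).ncard = Nat.card A :=
  (Nat.card_coe_set_eq _).symm

variable [Finite R]

theorem two_mul_card_le {A : Subgroup R} (hA : A ≠ ⊤) : 2 * Nat.card A ≤ Nat.card R := by
  rw [← A.card_mul_index, mul_comm]
  refine Nat.mul_le_mul_left _ ?_
  have h1 : A.index ≠ 0 := Subgroup.FiniteIndex.index_ne_zero
  have h2 : A.index ≠ 1 := fun h => hA (Subgroup.index_eq_one.1 h)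
  omega

theorem index_eq_two_or_three_mul_card_le {A : Subgroup R} (hA : A ≠ ⊤) :
    A.index = 2 ∨ 3 * Nat.card A ≤ Nat.card R := by
  have h1 : A.index ≠ 0 := Subgroup.FiniteIndex.index_ne_zero
  have h2 : A.index ≠ 1 := fun h => hA (Subgroup.index_eq_one.1 h)
  rcases eq_or_ne A.index 2 with h | h
  · exact Or.inl h
  · refine Or.inr ?_
    rw [← A.card_mul_index, mul_comm]
    exact Nat.mul_le_mul_left _ (by omega)

/-- Two proper subgroups miss at least a quarter of the group. -/
theorem four_mul_ncard_union_le {A B : Subgroup R} (hA : A ≠ ⊤) (hB : B ≠ ⊤) :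
    4 * ((A : Set R) ∪ B).ncard ≤ 3 * Nat.card R := by
  have h1 := Set.ncard_union_add_ncard_inter (A : Set R) B
  rw [← Subgroup.coe_inf, ncard_coe_subgroup, ncard_coe_subgroup, ncard_coe_subgroup] at h1
  have hA2 := two_mul_card_le hA
  have hB2 := two_mul_card_le hB
  have h2 : Nat.card A * Nat.card B ≤ Nat.card R * Nat.card ↥(A ⊓ B) := by
    have h3 := Subgroup.index_inf_le (H := A) (K := B)
    have ha := A.card_mul_index
    have hb := B.card_mul_index
    have hab := (A ⊓ B).card_mul_index
    have hpos : 0 < (A ⊓ B).index := Nat.pos_of_ne_zero Subgroup.FiniteIndex.index_ne_zero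
    refine Nat.le_of_mul_le_mul_right ?_ hpos
    calc Nat.card A * Nat.card B * (A ⊓ B).index
        ≤ Nat.card A * Nat.card B * (A.index * B.index) := Nat.mul_le_mul_left _ h3
      _ = (Nat.card A * A.index) * (Nat.card B * B.index) := by ring
      _ = Nat.card R * (Nat.card ↥(A ⊓ B) * (A ⊓ B).index) := by rw [ha, hb, hab]
      _ = _ := by ring
  have hn : 0 < Nat.card R := Nat.card_pos
  zify at *
  -- With `a`, `b`, `n` the orders of `A`, `B`, `R`, the complement of the union has at least `(n -
  -- a)(n - b)/n ≥ n/4` elements.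
  nlinarith [mul_nonneg (sub_nonneg.2 hA2) (sub_nonneg.2 hB2)]

end Counting

/-! ### Stabilizers that fix or invert most points: relations, and fixed points of index 2 -/

section Inversion

variable {R : Type*} [Group R]

/-- The properties of the point stabilizer in a permutation group containing the right regular
representation that concern its action on points. -/
structure IsStabilizerFamily (P : Set (R → R)) : Prop where
  map_one : ∀ h ∈ P, h 1 = 1
  exists_map_mul : ∀ h ∈ P, ∀ x, ∃ h' ∈ P, ∀ y, h (y * x) = h' y * h x

/-- The points that every map in `P` fixes or inverts. -/
def invertedPoints (P : Set (R → R)) : Set R :=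
  {x | ∀ h ∈ P, h x = x ∨ h x = x⁻¹}

variable {P : Set (R → R)} (hP : IsStabilizerFamily P)

/-- The common fixed points of a stabilizer form a subgroup. -/
def fixedSubgroup : Subgroup R where
  carrier := {x | ∀ h ∈ P, h x = x}
  one_mem' := hP.map_one
  mul_mem' := by
    intro y x hy hx h hh
    obtain ⟨h', hh', e⟩ := hP.exists_map_mul h hh x
    rw [e, hy h' hh', hx h hh]
  inv_mem' := by
    intro x hx h hh
    obtain ⟨h', hh', e⟩ := hP.exists_map_mul h hh x⁻¹
    have h1 := e x
    rw [mul_inv_cancel, hP.map_one h hh, hx h' hh'] at h1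
    exact (inv_eq_of_mul_eq_one_right h1.symm).symm

theorem mem_fixedSubgroup {x : R} : x ∈ fixedSubgroup hP ↔ ∀ h ∈ P, h x = x := Iff.rfl

/-- Choose `h` with `h x = x⁻¹ ≠ x` and expand `h (y * x) = h' y * x⁻¹`. Of the four sign choices
for `y * x` and `y`, fixing both would force `x = x⁻¹`; the others give the three alternatives. -/
theorem mul_relation {x y : R} (hx : x ∈ invertedPoints P) (hx' : x ∉ fixedSubgroup hP)
    (hy : y ∈ invertedPoints P) (hyx : y * x ∈ invertedPoints P) :
    y * x = x * y ∨ y * x = x * y⁻¹ ∨ y * y = x⁻¹ * x⁻¹ := by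
  rw [mem_fixedSubgroup] at hx'
  push Not at hx'
  obtain ⟨h, hh, hne⟩ := hx'
  have hxi : h x = x⁻¹ := (hx h hh).resolve_left hne
  obtain ⟨h', hh', e⟩ := hP.exists_map_mul h hh x
  have e1 := e y
  rw [hxi] at e1
  rcases hyx h hh with h1 | h1 <;> rcases hy h' hh' with h2 | h2 <;> rw [h1, h2] at e1
  · exact absurd (hxi.trans (mul_left_cancel e1).symm) hne
  · right; right
    calc y * y = y * (y * x) * x⁻¹ := by group
      _ = _ := by rw [e1]; group
  · right; left
    have := congrArg (·⁻¹) e1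
    simpa using this
  · left
    have := congrArg (·⁻¹) e1
    simpa using this

theorem mul_eq_of_mem_fixedSubgroup {x y : R} (hx : x ∈ invertedPoints P)
    (hx' : x ∉ fixedSubgroup hP) (hy : y ∈ fixedSubgroup hP)
    (hyx : y * x ∈ invertedPoints P) : y * x = x * y⁻¹ := by
  rw [mem_fixedSubgroup] at hx'
  push Not at hx'
  obtain ⟨h, hh, hne⟩ := hx'
  have hxi : h x = x⁻¹ := (hx h hh).resolve_left hne
  obtain ⟨h', hh', e⟩ := hP.exists_map_mul h hh x
  have e1 := e y
  rw [hxi, hy h' hh'] at e1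
  rcases hyx h hh with h1 | h1 <;> rw [h1] at e1
  · exact absurd (hxi.trans (mul_left_cancel e1).symm) hne
  · have := congrArg (·⁻¹) e1
    simpa using this

theorem mul_self_ne_one {x : R} (hx : x ∈ invertedPoints P) (hx' : x ∉ fixedSubgroup hP) :
    x * x ≠ 1 := by
  intro h1
  refine hx' fun h hh => ?_
  rcases hx h hh with h2 | h2
  · exact h2
  · rw [h2, inv_eq_of_mul_eq_one_left h1]

theorem orderOf_eq_four {x : R} (h1 : x * x ≠ 1) (h2 : x * x * (x * x) = 1) :
    orderOf x = 4 := by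
  have : Fact (Nat.Prime 2) := ⟨Nat.prime_two⟩
  have := orderOf_eq_prime_pow (x := x) (n := 1) (p := 2) (by simpa [pow_two] using h1)
    (by simpa [pow_succ, mul_assoc] using h2)
  simpa using this

variable [Finite R]

theorem isGeneralizedDicyclic_of_index_fixedSubgroup_eq_two
    (hY : 24 * (invertedPoints P)ᶜ.ncard < Nat.card R) (hindex : (fixedSubgroup hP).index = 2)
    (hR : ¬ ∀ a b : R, a * b = b * a) : IsGeneralizedDicyclic R := by
  set A := fixedSubgroup hP with hA
  set Y := (invertedPoints P)ᶜ with hYdef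
  have hcard := A.card_mul_index
  rw [hindex] at hcard
  have hAc : (A : Set R).ncard + (A : Set R)ᶜ.ncard = Nat.card R := Set.ncard_add_ncard_compl _
  rw [ncard_coe_subgroup] at hAc
  obtain ⟨x, hxA, hxY⟩ := exists_notMem_of_card_lt Y (A : Set R) ![fun y => y]
    (by simp [Function.Injective]) (by rw [ncard_coe_subgroup]; omega)
  have hxX : x ∈ invertedPoints P := by simpa [hYdef] using hxY 0
  have hinv : ∀ y ∈ A, y * x ∉ Y → y * x = x * y⁻¹ := fun y hy hyx =>
    mul_eq_of_mem_fixedSubgroup hP hxX hxA hy (by simpa [hYdef] using hyx)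
  -- Conjugation by `x` is multiplicative and inversion reverses products, so agreement of the two
  -- at `a`, `b` and `a * b` forces commutation.
  have hcomm1 : ∀ a ∈ A, a * x ∉ Y → ∀ b ∈ A, b * x ∉ Y → a * b * x ∉ Y → a * b = b * a := by
    intro a ha hax b hb hbx habx
    have h1 := hinv a ha hax
    have h2 := hinv b hb hbx
    have h3 := hinv (a * b) (A.mul_mem ha hb) habx
    have h4 : x * (b * a)⁻¹ = x * (a * b)⁻¹ := by
      calc x * (b * a)⁻¹ = (x * a⁻¹) * b⁻¹ := by group
        _ = a * (x * b⁻¹) := by rw [← h1]; group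
        _ = a * b * x := by rw [← h2]; group
        _ = _ := h3
    exact (inv_injective (mul_left_cancel h4)).symm
  have hcomm2 : ∀ a ∈ A, a * x ∉ Y → ∀ c ∈ A, a * c = c * a := by
    intro a ha hax c hc
    -- Avoiding the complement puts `b` in `A`. Then `a` commutes with `b` and with `c * b`, hence
    -- with `c`.
    obtain ⟨b, hbA, hb⟩ := exists_notMem_of_card_lt Y (A : Set R)ᶜ
      ![fun b => b * x, fun b => a * b * x, fun b => c * b * x, fun b => a * (c * b) * x]
      (by simp [Fin.forall_fin_succ, Function.Injective]) (by omega)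
    simp only [Fin.forall_fin_succ, Matrix.cons_val_zero, Matrix.cons_val_succ] at hb
    obtain ⟨hb1, hb2, hb3, hb4, -⟩ := hb
    have hb' : b ∈ A := by simpa using hbA
    have h1 := hcomm1 a ha hax b hb' hb1 hb2
    have h2 := hcomm1 a ha hax (c * b) (A.mul_mem hc hb') hb3 hb4
    refine mul_right_cancel (b := b) ?_
    calc a * c * b = c * b * a := by rw [mul_assoc, h2]
      _ = c * a * b := by rw [mul_assoc, ← h1, mul_assoc]
  have hcomm3 : ∀ a ∈ A, ∃ b ∈ A, b * x ∉ Y ∧ a * b * x ∉ Y := by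
    intro a ha
    obtain ⟨b, hbA, hb⟩ := exists_notMem_of_card_lt Y (A : Set R)ᶜ
      ![fun b => b * x, fun b => a * b * x]
      (by simp [Fin.forall_fin_succ, Function.Injective]) (by omega)
    simp only [Fin.forall_fin_succ, Matrix.cons_val_zero, Matrix.cons_val_succ] at hb
    exact ⟨b, by simpa using hbA, hb.1, hb.2.1⟩
  have hcomm : ∀ a ∈ A, ∀ c ∈ A, a * c = c * a := by
    intro a ha c hc
    obtain ⟨b, hb, hb1, hb2⟩ := hcomm3 a ha
    have h1 := hcomm2 b hb hb1 c hc
    have h2 := hcomm2 (a * b) (A.mul_mem ha hb) hb2 c hc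
    refine mul_right_cancel (b := b) ?_
    calc a * c * b = a * b * c := by rw [mul_assoc, ← h1, mul_assoc]
      _ = c * a * b := by rw [h2, mul_assoc]
  have hinvA : ∀ a ∈ A, a * x = x * a⁻¹ := by
    intro a ha
    obtain ⟨b, hb, hb1, hb2⟩ := hcomm3 a ha
    have h1 := hinv b hb hb1
    have h2 := hinv (a * b) (A.mul_mem ha hb) hb2
    have h3 : a * x * b⁻¹ = x * a⁻¹ * b⁻¹ := by
      calc a * x * b⁻¹ = a * b * x := by rw [mul_assoc, ← h1, mul_assoc]
        _ = x * (b * a)⁻¹ := by rw [h2, hcomm a ha b hb]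
        _ = x * a⁻¹ * b⁻¹ := by group
    exact mul_right_cancel h3
  -- The square of `x` lies in `A`, so it is inverted by `x`, with which it also commutes.
  have hxx := hinvA (x * x) (Subgroup.mul_self_mem_of_index_two hindex x)
  have h4 : x * x * (x * x) = 1 := by
    have h5 : x * (x * x) = x * (x * x)⁻¹ := by rw [← hxx, mul_assoc]
    have h6 := mul_left_cancel h5
    nth_rewrite 1 [h6]
    exact inv_mul_cancel _
  refine ⟨hR, A, Subgroup.normal_of_index_eq_two hindex, hindex, hcomm, x, hxA,
    orderOf_eq_four (mul_self_ne_one hP hxX hxA) h4, fun a ha => ?_⟩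
  rw [mul_assoc, hinvA a ha, inv_mul_cancel_left]

end Inversion

/-! ### Stabilizers that fix or invert most points: central fixed points -/

section Inversion

variable {R : Type*} [Group R] {P : Set (R → R)} (hP : IsStabilizerFamily P)

/-- Noncommuting points lie outside the central fixed subgroup, so `mul_relation` applies in both
orders. When neither order gives the square relation directly, `y * x * y = x` and `x * y * x = y`
yield equal squares, and moving `y * y` past `x` inverts it. -/
theorem mul_self_eq_inv_mul_inv
    (hA : fixedSubgroup hP ≤ Subgroup.center R)
    {x y : R} (hxy : y * x ≠ x * y) (hx : x ∈ invertedPoints P)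
    (hy : y ∈ invertedPoints P) (h1 : x * y ∈ invertedPoints P)
    (h2 : y * x ∈ invertedPoints P) : x * x = y⁻¹ * y⁻¹ := by
  have hx' : x ∉ fixedSubgroup hP := fun h => hxy (Subgroup.mem_center_iff.1 (hA h) y)
  have hy' : y ∉ fixedSubgroup hP := fun h => hxy (Subgroup.mem_center_iff.1 (hA h) x).symm
  rcases mul_relation hP hx hx' hy h2 with h3 | h3 | h3
  · exact absurd h3 hxy
  · rcases mul_relation hP hy hy' hx h1 with h4 | h4 | h4
    · exact absurd h4.symm hxy
    · have h5 : y * x * y = x := by rw [h3]; group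
      have h6 : x * y * x = y := by rw [h4]; group
      have h7 : x * x = y * y := by
        calc x * x = x * (y * x * y) := by rw [h5]
          _ = x * y * x * y := by group
          _ = y * y := by rw [h6]
      have h8 : y * y * x = x * (y⁻¹ * y⁻¹) := by
        rw [mul_assoc, h3, ← mul_assoc, h3, mul_assoc]
      rw [← h7] at h8
      refine mul_left_cancel (a := x) ?_
      rw [← h8]; group
    · exact h4
  · rw [← inv_inj, mul_inv_rev, mul_inv_rev, inv_inv, ← h3]

variable [Finite R]

/-- A fixed `y` satisfies `y * x = x * y⁻¹` for most `x` outside the fixed subgroup. Using this for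
both `x` and `r * x` shows that `y` commutes with `r`. -/
theorem fixedSubgroup_le_center (hY : 24 * (invertedPoints P)ᶜ.ncard < Nat.card R)
    (hcard : 3 * Nat.card (fixedSubgroup hP) ≤ Nat.card R) :
    fixedSubgroup hP ≤ Subgroup.center R := by
  intro y hy
  rw [Subgroup.mem_center_iff]
  intro r
  set A := fixedSubgroup hP with hA
  set Y := (invertedPoints P)ᶜ with hYdef
  have hV := Set.ncard_union_le (A : Set R) ((r * ·) ⁻¹' (A : Set R))
  have hV' : ((r * ·) ⁻¹' (A : Set R)).ncard ≤ (A : Set R).ncard :=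
    Set.ncard_le_ncard_of_injOn (r * ·) (fun a ha => ha) (mul_right_injective r).injOn
      (Set.toFinite _)
  rw [ncard_coe_subgroup] at hV hV'
  obtain ⟨x, hxV, hx⟩ := exists_notMem_of_card_lt Y ((A : Set R) ∪ (r * ·) ⁻¹' (A : Set R))
    ![fun x => x, fun x => r * x, fun x => y * x, fun x => y * (r * x)]
    (by simp [Fin.forall_fin_succ, Function.Injective]) (by omega)
  simp only [Fin.forall_fin_succ, Matrix.cons_val_zero, Matrix.cons_val_succ, hYdef,
    Set.mem_compl_iff, not_not] at hx
  obtain ⟨hx1, hx2, hx3, hx4, -⟩ := hx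
  rw [Set.mem_union, not_or] at hxV
  have h1 := mul_eq_of_mem_fixedSubgroup hP hx1 hxV.1 hy hx3
  have h2 := mul_eq_of_mem_fixedSubgroup hP hx2 hxV.2 hy hx4
  refine mul_right_cancel (b := x) ?_
  rw [mul_assoc, mul_assoc, h2, h1, mul_assoc]

theorem mul_self_mul_mul_self_eq_one
    (hY : 24 * (invertedPoints P)ᶜ.ncard < Nat.card R)
    (hA : fixedSubgroup hP ≤ Subgroup.center R) {x : R} (hx : x ∈ invertedPoints P)
    (hxc : x ∉ Subgroup.center R) : x * x * (x * x) = 1 := by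
  set Y := (invertedPoints P)ᶜ with hYdef
  have hC : Subgroup.centralizer {x} ≠ ⊤ := by
    rwa [Ne, Subgroup.centralizer_eq_top_iff_subset, Set.singleton_subset_iff]
  have hC2 := two_mul_card_le hC
  -- Both `y` and `y⁻¹` are made admissible, so that `x * x` equals both `y⁻¹ * y⁻¹` and `y * y`.
  obtain ⟨y, hyC, hy⟩ := exists_notMem_of_card_lt Y (Subgroup.centralizer {x} : Set R)
    ![fun y => y, fun y => y⁻¹, fun y => x * y, fun y => y * x, fun y => x * y⁻¹,
      fun y => y⁻¹ * x] (by simp [Fin.forall_fin_succ, Function.Injective])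
    (by rw [ncard_coe_subgroup]; omega)
  simp only [Fin.forall_fin_succ, Matrix.cons_val_zero, Matrix.cons_val_succ, hYdef,
    Set.mem_compl_iff, not_not] at hy
  obtain ⟨hy1, hy2, hy3, hy4, hy5, hy6, -⟩ := hy
  have hyC1 : y * x ≠ x * y := fun h => hyC (Subgroup.mem_centralizer_singleton_iff.2 h)
  have hyC2 : y⁻¹ * x ≠ x * y⁻¹ := fun h => hyC
    (inv_mem_iff.1 (Subgroup.mem_centralizer_singleton_iff.2 h))
  have h1 := mul_self_eq_inv_mul_inv hP hA hyC1 hx hy1 hy3 hy4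
  have h2 := mul_self_eq_inv_mul_inv hP hA hyC2 hx hy2 hy5 hy6
  nth_rewrite 1 [h1]
  rw [h2]
  group

theorem mul_self_eq_mul_self
    (hY : 24 * (invertedPoints P)ᶜ.ncard < Nat.card R)
    (hA : fixedSubgroup hP ≤ Subgroup.center R) {x x' : R} (hx : x ∈ invertedPoints P)
    (hxc : x ∉ Subgroup.center R) (hx' : x' ∈ invertedPoints P)
    (hxc' : x' ∉ Subgroup.center R) : x * x = x' * x' := by
  set Y := (invertedPoints P)ᶜ with hYdef
  have hC : ∀ {x}, x ∉ Subgroup.center R → Subgroup.centralizer {x} ≠ ⊤ := fun h => by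
    rwa [Ne, Subgroup.centralizer_eq_top_iff_subset, Set.singleton_subset_iff]
  have hC2 := four_mul_ncard_union_le (hC hxc) (hC hxc')
  -- A single `y` commuting with neither point is compared with both. This is the tightest use of
  -- 24: two centralizers leave a quarter of the group, and five translates exclude less than 5/24.
  obtain ⟨y, hyC, hy⟩ := exists_notMem_of_card_lt Y
    ((Subgroup.centralizer {x} : Set R) ∪ Subgroup.centralizer {x'})
    ![fun y => y, fun y => x * y, fun y => y * x, fun y => x' * y, fun y => y * x']
    (by simp [Fin.forall_fin_succ, Function.Injective]) (by omega)
  simp only [Fin.forall_fin_succ, Matrix.cons_val_zero, Matrix.cons_val_succ, hYdef,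
    Set.mem_compl_iff, not_not] at hy
  obtain ⟨hy1, hy2, hy3, hy4, hy5, -⟩ := hy
  rw [Set.mem_union, not_or] at hyC
  have h1 : y * x ≠ x * y := fun h => hyC.1 (Subgroup.mem_centralizer_singleton_iff.2 h)
  have h2 : y * x' ≠ x' * y := fun h => hyC.2 (Subgroup.mem_centralizer_singleton_iff.2 h)
  rw [mul_self_eq_inv_mul_inv hP hA h1 hx hy1 hy2 hy3,
    mul_self_eq_inv_mul_inv hP hA h2 hx' hy1 hy4 hy5]

theorem mul_eq_mul_inv_of_mem_invertedPoints
    (hY : 24 * (invertedPoints P)ᶜ.ncard < Nat.card R)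
    (hA : fixedSubgroup hP ≤ Subgroup.center R) {x y : R} (hxy : y * x ≠ x * y)
    (hy : y ∈ invertedPoints P) (hyx : y * x ∈ invertedPoints P) : x * y = y * x⁻¹ := by
  have hyc : y ∉ Subgroup.center R := fun h => hxy (Subgroup.mem_center_iff.1 h x).symm
  have hyxc : y * x ∉ Subgroup.center R := fun h => hxy (by
    have := Subgroup.mem_center_iff.1 h y
    rw [mul_assoc y x y] at this
    exact mul_left_cancel this)
  have h1 := mul_self_eq_mul_self hP hY hA hyx hyxc hy hyc
  have h2 : x * y * x = y := by
    refine mul_left_cancel (a := y) ?_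
    rw [← h1]; group
  nth_rewrite 2 [← h2]
  group

/-- All noncentral inverted points share one square, of order 2. This makes the centralizer `C` of
such a point `x` equal to `Z ∪ x * Z` with `Z` the centre, of exponent at most 2; `C` is the abelian
subgroup of index 2, inverted by any suitable `v` outside it. -/
theorem isGeneralizedDicyclic_of_fixedSubgroup_le_center
    (hY : 24 * (invertedPoints P)ᶜ.ncard < Nat.card R)
    (hA : fixedSubgroup hP ≤ Subgroup.center R)
    (hR : ¬ ∀ a b : R, a * b = b * a) : IsGeneralizedDicyclic R := by
  set Y := (invertedPoints P)ᶜ with hYdef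
  set Z := Subgroup.center R with hZdef
  have hZtop : Z ≠ ⊤ := fun h => hR fun a b =>
    Subgroup.mem_center_iff.1 (show b ∈ Z from h ▸ Subgroup.mem_top b) a
  have hZ2 := two_mul_card_le hZtop
  obtain ⟨x, hxZ, hxY⟩ := exists_notMem_of_card_lt Y (Z : Set R) ![fun y => y]
    (by simp [Function.Injective]) (by rw [ncard_coe_subgroup]; omega)
  have hx : x ∈ invertedPoints P := by simpa [hYdef] using hxY 0
  set C := Subgroup.centralizer {x} with hCdef
  have hxC : x ∈ C := Subgroup.mem_centralizer_singleton_iff.2 rfl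
  have hZC : Z ≤ C := Subgroup.center_le_centralizer _
  have hCtop : C ≠ ⊤ := by
    rwa [Ne, Subgroup.centralizer_eq_top_iff_subset, Set.singleton_subset_iff]
  have hC2 := two_mul_card_le hCtop
  have hsq : x * x ≠ 1 := mul_self_ne_one hP hx fun h => hxZ (hA h)
  have hsq2 : x * x * (x * x) = 1 := mul_self_mul_mul_self_eq_one hP hY hA hx hxZ
  have hZsq : ∀ z ∈ Z, z * z = 1 := by
    intro z hz
    obtain ⟨u, huZ, hu⟩ := exists_notMem_of_card_lt Y (Z : Set R) ![fun y => y, fun y => y * z]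
      (by simp [Fin.forall_fin_succ, Function.Injective]) (by rw [ncard_coe_subgroup]; omega)
    simp only [Fin.forall_fin_succ, Matrix.cons_val_zero, Matrix.cons_val_succ, hYdef,
      Set.mem_compl_iff, not_not] at hu
    have h1 := mul_self_eq_mul_self hP hY hA hu.1 huZ hu.2.1
      (fun h => huZ ((Z.mul_mem_cancel_right hz).1 h))
    have h2 : u * z * (u * z) = u * u * (z * z) := by
      rw [mul_assoc, ← mul_assoc z u z, ← Subgroup.mem_center_iff.1 hz u]; group
    rw [h2] at h1
    exact (mul_eq_left.1 h1.symm)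
  have hinvx : ∀ y, y ∉ C → y ∉ Y → y * x ∉ Y → x * y = y * x⁻¹ := fun y h1 h2 h3 =>
    mul_eq_mul_inv_of_mem_invertedPoints hP hY hA
      (fun h => h1 (Subgroup.mem_centralizer_singleton_iff.2 h))
      (by simpa [hYdef] using h2) (by simpa [hYdef] using h3)
  obtain ⟨v, hvC, hv⟩ := exists_notMem_of_card_lt Y (C : Set R) ![fun y => y, fun y => y * x]
    (by simp [Fin.forall_fin_succ, Function.Injective]) (by rw [ncard_coe_subgroup]; omega)
  simp only [Fin.forall_fin_succ, Matrix.cons_val_zero, Matrix.cons_val_succ] at hv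
  obtain ⟨hv1, hv2, -⟩ := hv
  have hvx := hinvx v hvC hv1 hv2
  -- Two elements that invert `x` differ by one that centralizes it, so almost every element lies in
  -- `C` or in the coset of `v`.
  have hCcard : Nat.card R ≤ 2 * Nat.card C + 2 * Y.ncard := by
    by_contra! hlt
    have hV := Set.ncard_union_le (C : Set R) ((· * v⁻¹) ⁻¹' (C : Set R))
    have hV' : ((· * v⁻¹) ⁻¹' (C : Set R)).ncard ≤ (C : Set R).ncard :=
      Set.ncard_le_ncard_of_injOn (· * v⁻¹) (fun a ha => ha) (mul_left_injective _).injOn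
        (Set.toFinite _)
    rw [ncard_coe_subgroup] at hV hV'
    obtain ⟨y, hyC, hy⟩ := exists_notMem_of_card_lt Y ((C : Set R) ∪ (· * v⁻¹) ⁻¹' (C : Set R))
      ![fun y => y, fun y => y * x]
      (by simp [Fin.forall_fin_succ, Function.Injective]) (by omega)
    simp only [Fin.forall_fin_succ, Matrix.cons_val_zero, Matrix.cons_val_succ] at hy
    rw [Set.mem_union, not_or] at hyC
    have hyx := hinvx y hyC.1 hy.1 hy.2.1
    refine hyC.2 (Subgroup.mem_centralizer_singleton_iff.2 ?_)
    have h1 : v⁻¹ * x = x⁻¹ * v⁻¹ := by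
      have : x * v * x = v := by rw [hvx]; group
      nth_rewrite 1 [← this]; group
    rw [mul_assoc, h1, ← mul_assoc, ← hyx, mul_assoc]
  have hCindex : C.index = 2 := by
    rcases index_eq_two_or_three_mul_card_le hCtop with h | h
    · exact h
    · omega
  -- If `u` in `C` and `x * u` were noncentral and inverted, then `x`, `u` and `x * u` would have
  -- equal squares; as `u` commutes with `x`, this gives `x * x = x * x * (u * u) = 1`.
  have hCZ : Nat.card C ≤ 2 * Nat.card Z + 2 * Y.ncard := by
    by_contra! hlt
    have hV := Set.ncard_union_le ((C : Set R)ᶜ ∪ Z) ((x * ·) ⁻¹' (Z : Set R))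
    have hV2 := Set.ncard_union_le (C : Set R)ᶜ Z
    have hV' : ((x * ·) ⁻¹' (Z : Set R)).ncard ≤ (Z : Set R).ncard :=
      Set.ncard_le_ncard_of_injOn (x * ·) (fun a ha => ha) (mul_right_injective _).injOn
        (Set.toFinite _)
    have hCc : (C : Set R).ncard + (C : Set R)ᶜ.ncard = Nat.card R :=
      Set.ncard_add_ncard_compl _
    rw [ncard_coe_subgroup] at hV' hV2 hCc
    obtain ⟨u, hu, huY⟩ := exists_notMem_of_card_lt Y
      ((C : Set R)ᶜ ∪ Z ∪ (x * ·) ⁻¹' (Z : Set R)) ![fun y => y, fun y => x * y]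
      (by simp [Fin.forall_fin_succ, Function.Injective]) (by omega)
    simp only [Fin.forall_fin_succ, Matrix.cons_val_zero, Matrix.cons_val_succ, hYdef,
      Set.mem_compl_iff, not_not] at huY
    simp only [Set.mem_union, not_or, Set.mem_compl_iff, not_not] at hu
    obtain ⟨⟨huC, huZ⟩, hxuZ⟩ := hu
    have h1 := mul_self_eq_mul_self hP hY hA huY.1 huZ hx hxZ
    have h2 := mul_self_eq_mul_self hP hY hA huY.2.1 hxuZ hx hxZ
    have h3 : u * x = x * u := Subgroup.mem_centralizer_singleton_iff.1 huC
    refine hsq ?_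
    calc x * x = x * (u * x) * u := by rw [← h2]; group
      _ = x * x * (u * u) := by rw [h3]; group
      _ = 1 := by rw [h1, hsq2]
  have hrel : (Z.subgroupOf C).index = 2 := by
    have hne : Z.subgroupOf C ≠ ⊤ := fun h => hxZ (Subgroup.subgroupOf_eq_top.1 h hxC)
    have hcard : Nat.card (Z.subgroupOf C) = Nat.card Z :=
      Nat.card_congr (Subgroup.subgroupOfEquivOfLe hZC).toEquiv
    rcases index_eq_two_or_three_mul_card_le hne with h | h
    · exact h
    · rw [hcard] at h
      omega
  have hCform : ∀ c ∈ C, ∃ z ∈ Z, c = z ∨ c = x * z := by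
    intro c hc
    by_cases hcZ : c ∈ Z
    · exact ⟨c, hcZ, Or.inl rfl⟩
    · refine ⟨x⁻¹ * c, ?_, Or.inr (by group)⟩
      have := (Subgroup.mul_mem_iff_of_index_two hrel (a := ⟨x⁻¹, C.inv_mem hxC⟩)
        (b := ⟨c, hc⟩))
      simp only [Subgroup.mem_subgroupOf, Subgroup.coe_mul] at this
      rw [this]
      simp [hcZ, show x ∉ Z from hxZ]
  have hvZ : v ∉ Z := fun h => hvC (hZC h)
  have hvX : v ∈ invertedPoints P := by simpa [hYdef] using hv1
  refine ⟨hR, C, Subgroup.normal_of_index_eq_two hCindex, hCindex, ?_, v, hvC,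
    orderOf_eq_four (mul_self_ne_one hP hvX fun h => hvZ (hA h))
      (mul_self_mul_mul_self_eq_one hP hY hA hvX hvZ), ?_⟩
  · intro a ha b hb
    obtain ⟨z, hz, rfl | rfl⟩ := hCform a ha
    · exact (Subgroup.mem_center_iff.1 hz b).symm
    · rw [mul_assoc, ← Subgroup.mem_center_iff.1 hz b, ← mul_assoc, ← mul_assoc,
        Subgroup.mem_centralizer_singleton_iff.1 hb]
  · intro a ha
    have key : ∀ z ∈ Z, v⁻¹ * z * v = z⁻¹ := fun z hz => by
      rw [Subgroup.mem_center_iff.1 hz, mul_assoc, inv_mul_cancel, mul_one,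
        eq_comm, inv_eq_of_mul_eq_one_left (hZsq z hz)]
    obtain ⟨z, hz, rfl | rfl⟩ := hCform a ha
    · exact key _ hz
    · calc v⁻¹ * (x * z) * v = v⁻¹ * (x * v) * (v⁻¹ * z * v) := by group
        _ = x⁻¹ * z⁻¹ := by rw [hvx, key z hz]; group
        _ = (x * z)⁻¹ := by
          rw [← mul_inv_rev, Subgroup.mem_center_iff.1 hz x]

/-- If a nontrivial stabilizer fixes or inverts almost all points, then the regular group is
abelian of exponent greater than `2` or generalized dicyclic. -/
theorem isAbelianOfExponentGTTwo_or_isGeneralizedDicyclic (hP : IsStabilizerFamily P)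
    (hne : ∃ h ∈ P, ∃ x, h x ≠ x)
    (hY : 24 * (invertedPoints P)ᶜ.ncard < Nat.card R) :
    IsAbelianOfExponentGTTwo R ∨ IsGeneralizedDicyclic R := by
  have hAtop : fixedSubgroup hP ≠ ⊤ := by
    intro h
    obtain ⟨h', hh', x, hx⟩ := hne
    exact hx ((mem_fixedSubgroup hP).1 (h ▸ Subgroup.mem_top x) h' hh')
  by_cases hR : ∀ a b : R, a * b = b * a
  · refine Or.inl ⟨hR, ?_⟩
    have hA2 := two_mul_card_le hAtop
    obtain ⟨x, hxA, hxY⟩ := exists_notMem_of_card_lt (invertedPoints P)ᶜ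
      (fixedSubgroup hP : Set R) ![fun y => y]
      (by simp [Function.Injective]) (by rw [ncard_coe_subgroup]; omega)
    have hx : x ∈ invertedPoints P := by simpa using hxY 0
    have hsq := mul_self_ne_one hP hx hxA
    have hpos := Monoid.exponent_pos_of_exists (G := R) (Nat.card R) Nat.card_pos
      fun g => pow_card_eq_one'
    by_contra! hle
    refine hsq ?_
    have h1 := Monoid.pow_exponent_eq_one x
    interval_cases h2 : Monoid.exponent R
    · rw [pow_one] at h1
      rw [h1, mul_one]
    · rwa [pow_two] at h1
  · refine Or.inr ?_
    rcases index_eq_two_or_three_mul_card_le hAtop with h | h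
    · exact isGeneralizedDicyclic_of_index_fixedSubgroup_eq_two hP hY h hR
    · exact isGeneralizedDicyclic_of_fixedSubgroup_le_center hP hY
        (fixedSubgroup_le_center hP hY h) hR

end Inversion

/-! ### Inverse-closed sets and transversals for inversion -/

section Transversal

/-- A transversal for inversion, with respect to an injective labelling. -/
def inversionTransversal {X : Type*} [Inv X] (e : X → ℕ) : Set X :=
  {x | e x ≤ e x⁻¹}

theorem mem_inversionTransversal_or_inv_mem {X : Type*} [InvolutiveInv X] (e : X → ℕ) (x : X) :
    x ∈ inversionTransversal e ∨ x⁻¹ ∈ inversionTransversal e := by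
  simp only [inversionTransversal, Set.mem_ofPred_eq, inv_inv]
  exact le_total _ _

theorem eq_of_inv_eq_of_mem_inversionTransversal {X : Type*} [InvolutiveInv X] {e : X → ℕ}
    (he : Function.Injective e) {x y : X} (hx : x ∈ inversionTransversal e)
    (hy : y ∈ inversionTransversal e) (h : x⁻¹ = y) : x = y := by
  subst h
  simp only [inversionTransversal, Set.mem_ofPred_eq, inv_inv] at hx hy
  exact he (le_antisymm hx hy)

theorem exists_injective_nat (X : Type*) [Finite X] : ∃ e : X → ℕ, Function.Injective e :=
  ⟨fun x => Finite.equivFin X x, fun _ _ h => (Finite.equivFin X).injective (Fin.ext h)⟩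

/-- The transversal and its inverse cover `R` and meet exactly in the solutions of `x ^ 2 = 1`. -/
theorem ncard_inversionTransversal {R : Type*} [Group R] [Finite R] {e : R → ℕ}
    (he : Function.Injective e) :
    ((inversionTransversal e).ncard : ℝ) = c (Set.univ : Set R) := by
  set T := inversionTransversal e with hT
  have h1 := Set.ncard_union_add_ncard_inter T T⁻¹
  have h2 : T ∪ T⁻¹ = Set.univ :=
    Set.eq_univ_of_forall fun x => mem_inversionTransversal_or_inv_mem e x
  have h3 : T ∩ T⁻¹ = {x ∈ (Set.univ : Set R) | x ^ 2 = 1} := by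
    ext x
    simp only [Set.mem_inter_iff, Set.mem_inv, Set.mem_ofPred_eq, Set.mem_univ, true_and]
    rw [pow_two, mul_eq_one_iff_eq_inv]
    constructor
    · rintro ⟨hx, hx'⟩
      exact eq_of_inv_eq_of_mem_inversionTransversal he hx hx' rfl
    · intro h
      have hx : x ∈ T := by rw [hT, inversionTransversal, Set.mem_ofPred_eq, ← h]
      exact ⟨hx, h ▸ hx⟩
  have h4 : T⁻¹.ncard = T.ncard := by
    rw [← Set.image_inv_eq_inv, Set.ncard_image_of_injective _ inv_injective]
  rw [h2, h3, h4] at h1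
  rw [c, eq_div_iff two_ne_zero]
  exact_mod_cast (by omega : T.ncard * 2 = _)

theorem ncard_setOf_inv_eq_le {R : Type*} [Group R] [Finite R] (e : R → ℕ) :
    {S : Set R | S⁻¹ = S}.ncard ≤ 2 ^ (inversionTransversal e).ncard := by
  rw [← Set.ncard_powerset]
  refine Set.ncard_le_ncard_of_injOn (fun S => S ∩ inversionTransversal e)
    (fun S _ => Set.inter_subset_right) ?_ (Set.toFinite _)
  intro S hS S' hS' h
  have key : ∀ {S S' : Set R}, S⁻¹ = S → S'⁻¹ = S' →
      S ∩ inversionTransversal e = S' ∩ inversionTransversal e → S ⊆ S' := by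
    intro S S' hS hS' h x hx
    rcases mem_inversionTransversal_or_inv_mem e x with hT | hT
    · exact ((Set.ext_iff.1 h x).1 ⟨hx, hT⟩).1
    · rw [← hS] at hx
      rw [← hS']
      exact ((Set.ext_iff.1 h x⁻¹).1 ⟨hx, hT⟩).1
  exact (key hS hS' h).antisymm (key hS' hS h.symm)

end Transversal

/-! ### Tied cosets and the toggling injection -/

section Cosets

variable {R : Type*} [Group R] {K : Subgroup R}

/-- The number of elements of `S` in a coset of `K`. -/
noncomputable def cosetCount (S : Set R) (q : R ⧸ K) : ℕ :=
  (S ∩ (QuotientGroup.mk : R → R ⧸ K) ⁻¹' {q}).ncard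

variable (K) in
/-- Two cosets are tied by a family of sets if each of its members has the same number of
elements in both. -/
def Tied (L : Set (Set R)) (q q' : R ⧸ K) : Prop :=
  ∀ S ∈ L, cosetCount S q = cosetCount S q'

theorem Tied.symm {L : Set (Set R)} {q q' : R ⧸ K} (h : Tied K L q q') : Tied K L q' q :=
  fun S hS => (h S hS).symm

theorem Tied.trans {L : Set (Set R)} {q q' q'' : R ⧸ K} (h : Tied K L q q')
    (h' : Tied K L q' q'') : Tied K L q q'' :=
  fun S hS => (h S hS).trans (h' S hS)

/-- The inverse-closed set generated by representatives of the cosets in `E`. -/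
def toggleSet (E : Set (R ⧸ K)) : Set R :=
  {x | ∃ d ∈ E, x = d.out ∨ x = d.out⁻¹}

theorem inv_toggleSet (E : Set (R ⧸ K)) : (toggleSet E)⁻¹ = toggleSet E := by
  ext x
  simp only [toggleSet, Set.mem_inv, Set.mem_ofPred_eq, inv_eq_iff_eq_inv (a := x), inv_inv,
    or_comm]

variable [K.Normal]

theorem cosetCount_inv {S : Set R} (hS : S⁻¹ = S) (q : R ⧸ K) :
    cosetCount S q⁻¹ = cosetCount S q := by
  have h : S ∩ (QuotientGroup.mk : R → R ⧸ K) ⁻¹' {q⁻¹} =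
      (S ∩ (QuotientGroup.mk : R → R ⧸ K) ⁻¹' {q})⁻¹ := by
    rw [Set.inter_inv, hS]
    ext x
    simp [inv_eq_iff_eq_inv]
  rw [cosetCount, h, ← Set.image_inv_eq_inv, Set.ncard_image_of_injective _ inv_injective,
    cosetCount]

theorem tied_inv {L : Set (Set R)} (hL : ∀ S ∈ L, S⁻¹ = S) (q : R ⧸ K) :
    Tied K L q q⁻¹ :=
  fun S hS => (cosetCount_inv (hL S hS) q).symm

variable (K) in
/-- Representatives of the inverse pairs of cosets that are tied to a coset with a smaller
label. -/
def dependentCosets (L : Set (Set R)) (e : R ⧸ K → ℕ) : Set (R ⧸ K) :=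
  {q | q ∈ inversionTransversal e ∧ ∃ q', Tied K L q q' ∧ e q' < e q}

variable (K) in
/-- The cosets that are tied to a coset other than themselves and their inverse. -/
def tiedCosets (L : Set (Set R)) : Set (R ⧸ K) :=
  {q | ∃ q', Tied K L q q' ∧ q' ≠ q ∧ q' ≠ q⁻¹}

theorem ncard_tiedCosets_le [Finite R] {L : Set (Set R)} (hL : ∀ S ∈ L, S⁻¹ = S)
    {e : R ⧸ K → ℕ} (he : Function.Injective e) :
    (tiedCosets K L).ncard ≤ 4 * (dependentCosets K L e).ncard := by
  set B := tiedCosets K L with hB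
  set D := dependentCosets K L e with hD
  set T := inversionTransversal e with hT
  have hBinv : ∀ q ∈ B, q⁻¹ ∈ B := by
    rintro q ⟨q', h, h1, h2⟩
    exact ⟨q', (tied_inv hL q).symm.trans h, h2, by rwa [inv_inv]⟩
  have h1 : B ⊆ (B ∩ T) ∪ (B ∩ T)⁻¹ := by
    intro q hq
    rcases mem_inversionTransversal_or_inv_mem e q with h | h
    · exact Or.inl ⟨hq, h⟩
    · exact Or.inr ⟨hBinv q hq, h⟩
  have h2 : B.ncard ≤ 2 * (B ∩ T).ncard := by
    have h3 := (Set.ncard_le_ncard h1 (Set.toFinite _)).trans (Set.ncard_union_le _ _)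
    rw [← Set.image_inv_eq_inv, Set.ncard_image_of_injective _ inv_injective] at h3
    omega
  -- A tied coset of `T` outside `D` has the least label in its tie class, so any other member of
  -- the class in `T` is dependent. Uniqueness of the minimum makes the choice of partner injective.
  -- Passing from `B` to `B ∩ T` and then to `D` loses a factor 2 each time.
  have h3 : ∀ q ∈ (B ∩ T) \ D, ∃ q' ∈ D, Tied K L q q' := by
    rintro q ⟨⟨⟨q', htied, hne, hne'⟩, hqT⟩, hqD⟩
    obtain ⟨q'', hq''T, htied'', hne''⟩ : ∃ q'' ∈ T, Tied K L q q'' ∧ q'' ≠ q := by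
      rcases mem_inversionTransversal_or_inv_mem e q' with h | h
      · exact ⟨q', h, htied, hne⟩
      · exact ⟨q'⁻¹, h, htied.trans (tied_inv hL q'), fun h => hne' (inv_eq_iff_eq_inv.1 h)⟩
    refine ⟨q'', ⟨hq''T, q, htied''.symm, ?_⟩, htied''⟩
    have hle : e q ≤ e q'' := not_lt.1 fun hlt => hqD ⟨hqT, q'', htied'', hlt⟩
    exact lt_of_le_of_ne hle fun h => hne'' (he h).symm
  choose! g hgD hg using h3
  have h4 : ((B ∩ T) \ D).ncard ≤ D.ncard := by
    refine Set.ncard_le_ncard_of_injOn g hgD ?_ (Set.toFinite _)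
    intro q hq q' hq' h
    have htied : Tied K L q q' := (hg q hq).trans (h ▸ (hg q' hq').symm)
    refine he (le_antisymm ?_ ?_)
    · exact not_lt.1 fun hlt => hq.2 ⟨hq.1.2, q', htied, hlt⟩
    · exact not_lt.1 fun hlt => hq'.2 ⟨hq'.1.2, q, htied.symm, hlt⟩
  have h5 : (B ∩ T).ncard ≤ ((B ∩ T) \ D).ncard + D.ncard :=
    Set.ncard_le_ncard_sdiff_add_ncard _ _ (Set.toFinite _)
  omega

theorem cosetCount_symmDiff_eq {S : Set R} {E : Set (R ⧸ K)} {q : R ⧸ K} (hq : q ∉ E)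
    (hq' : q⁻¹ ∉ E) : cosetCount (S ∆ toggleSet E) q = cosetCount S q := by
  have h : ∀ x : R, (QuotientGroup.mk x : R ⧸ K) = q → x ∉ toggleSet E := by
    rintro x rfl ⟨d, hd, rfl | rfl⟩
    · exact hq (by rwa [QuotientGroup.out_eq'])
    · exact hq' (by rwa [QuotientGroup.mk_inv, inv_inv, QuotientGroup.out_eq'])
  rw [cosetCount, cosetCount]
  congr 1
  ext x
  simp only [Set.mem_inter_iff, Set.mem_preimage, Set.mem_singleton_iff, Set.mem_symmDiff]
  have := h x
  tauto

theorem cosetCount_symmDiff_ne [Finite R] {S : Set R} (hS : S⁻¹ = S) {e : R ⧸ K → ℕ}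
    (he : Function.Injective e) {E : Set (R ⧸ K)} (hE : E ⊆ inversionTransversal e)
    {q : R ⧸ K} (hq : q ∈ E) : cosetCount (S ∆ toggleSet E) q ≠ cosetCount S q := by
  have hmem : ∀ x : R, (QuotientGroup.mk x : R ⧸ K) = q →
      (x ∈ toggleSet E ↔ x = q.out ∨ x = q.out⁻¹) := by
    rintro x hx
    constructor
    · rintro ⟨d, hd, h⟩
      have hdq : d = q := by
        rcases h with rfl | rfl
        · rwa [QuotientGroup.out_eq'] at hx
        · rw [QuotientGroup.mk_inv, QuotientGroup.out_eq'] at hx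
          exact eq_of_inv_eq_of_mem_inversionTransversal he (hE hd) (hE hq) hx
      rwa [hdq] at h
    · exact fun h => ⟨q, hq, h⟩
  -- The representative and its inverse are both in `S` or both outside it, so even in a
  -- self-inverse coset the toggle changes the count in one direction only.
  have hout : (QuotientGroup.mk q.out : R ⧸ K) = q := QuotientGroup.out_eq' q
  have hinv : q.out⁻¹ ∈ S ↔ q.out ∈ S := by
    rw [← Set.mem_inv, hS]
  by_cases hqS : q.out ∈ S
  · refine (Set.ncard_lt_ncard ?_ (Set.toFinite _)).ne
    refine ⟨?_, fun hsub => ?_⟩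
    · rintro x ⟨hx, hxq⟩
      refine ⟨?_, hxq⟩
      rcases hx with hx | hx
      · exact hx.1
      · rcases (hmem x hxq).1 hx.1 with rfl | rfl
        · exact hqS
        · exact hinv.2 hqS
    · rcases (hsub ⟨hqS, hout⟩).1 with h | h
      · exact h.2 ((hmem _ hout).2 (Or.inl rfl))
      · exact h.2 hqS
  · refine (Set.ncard_lt_ncard ?_ (Set.toFinite _)).ne'
    refine ⟨?_, fun hsub => ?_⟩
    · rintro x ⟨hx, hxq⟩
      refine ⟨Or.inl ⟨hx, fun h => ?_⟩, hxq⟩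
      rcases (hmem x hxq).1 h with rfl | rfl
      · exact hqS hx
      · exact hqS (hinv.1 hx)
    · exact hqS (hsub ⟨Or.inr ⟨(hmem _ hout).2 (Or.inl rfl), hqS⟩, hout⟩).1

/-- Toggling representatives of dependent cosets maps `L` and the subsets of the set of dependent
cosets injectively to the inverse-closed sets. -/
theorem injOn_symmDiff_toggleSet [Finite R] {L : Set (Set R)} (hL : ∀ S ∈ L, S⁻¹ = S)
    {e : R ⧸ K → ℕ} (he : Function.Injective e) :
    Set.InjOn (fun p : Set R × Set (R ⧸ K) => p.1 ∆ toggleSet p.2)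
      (L ×ˢ 𝒫 dependentCosets K L e) := by
  rintro ⟨S₁, E₁⟩ ⟨hS₁, hE₁⟩ ⟨S₂, E₂⟩ ⟨hS₂, hE₂⟩ h
  simp only at hS₁ hE₁ hS₂ hE₂ h
  rw [Set.mem_powerset_iff] at hE₁ hE₂
  -- The toggled set determines the original counts, by induction on labels: toggling leaves a coset
  -- with no smaller tied coset untouched, and any other coset inherits its count from a smaller
  -- label. The toggled cosets are then those dependent ones whose count has changed.
  have hcount : ∀ n, ∀ q : R ⧸ K, e q = n → cosetCount S₁ q = cosetCount S₂ q := by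
    intro n
    induction n using Nat.strong_induction_on with
    | _ n ih =>
      intro q hqn
      by_cases hq : ∃ q', Tied K L q q' ∧ e q' < e q
      · obtain ⟨q', htied, hlt⟩ := hq
        rw [htied S₁ hS₁, htied S₂ hS₂]
        exact ih _ (hqn ▸ hlt) q' rfl
      · have h1 : q ∉ dependentCosets K L e := fun hD => hq hD.2
        have h2 : q⁻¹ ∉ dependentCosets K L e := by
          rintro ⟨hT, q', htied, hlt⟩
          rw [inversionTransversal, Set.mem_ofPred_eq, inv_inv] at hT
          exact hq ⟨q', (tied_inv hL q).trans htied, hlt.trans_le hT⟩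
        rw [← cosetCount_symmDiff_eq (fun hE => h1 (hE₁ hE)) (fun hE => h2 (hE₁ hE)),
          ← cosetCount_symmDiff_eq (S := S₂) (fun hE => h1 (hE₂ hE))
            (fun hE => h2 (hE₂ hE)), h]
  have hsub : ∀ {E : Set (R ⧸ K)}, E ⊆ dependentCosets K L e → E ⊆ inversionTransversal e :=
    fun hE q hq => (hE hq).1
  have key : ∀ {S : Set R} {E : Set (R ⧸ K)}, S ∈ L → E ⊆ dependentCosets K L e →
      ∀ q ∈ dependentCosets K L e,
        (q ∈ E ↔ cosetCount (S ∆ toggleSet E) q ≠ cosetCount S q) := by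
    intro S E hS hE q hq
    refine ⟨fun h => cosetCount_symmDiff_ne (hL S hS) he (hsub hE) h, fun h => ?_⟩
    by_contra hqE
    refine h (cosetCount_symmDiff_eq hqE fun hqE' => hqE ?_)
    rwa [eq_of_inv_eq_of_mem_inversionTransversal he hq.1 (hsub hE hqE') rfl]
  have hE : E₁ = E₂ := by
    ext q
    have h' : q ∈ dependentCosets K L e → (q ∈ E₁ ↔ q ∈ E₂) := fun hq => by
      rw [key hS₁ hE₁ q hq, key hS₂ hE₂ q hq, h, hcount _ q rfl]
    exact ⟨fun hq => (h' (hE₁ hq)).1 hq, fun hq => (h' (hE₂ hq)).2 hq⟩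
  subst hE
  exact Prod.ext (symmDiff_left_injective _ h) rfl

theorem ncard_le_two_rpow [Finite R] {L : Set (Set R)} (hL : ∀ S ∈ L, S⁻¹ = S) :
    (L.ncard : ℝ) ≤ (2 : ℝ) ^ (c (Set.univ : Set R) - ((tiedCosets K L).ncard : ℝ) / 4) := by
  obtain ⟨e, he⟩ := exists_injective_nat R
  obtain ⟨e', he'⟩ := exists_injective_nat (R ⧸ K)
  have h1 := ncard_tiedCosets_le hL he'
  set D := dependentCosets K L e'
  have h2 : L.ncard * 2 ^ D.ncard ≤ 2 ^ (inversionTransversal e).ncard := by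
    rw [← Set.ncard_powerset, ← Set.ncard_prod]
    refine le_trans ?_ (ncard_setOf_inv_eq_le e)
    refine Set.ncard_le_ncard_of_injOn _ ?_ (injOn_symmDiff_toggleSet hL he') (Set.toFinite _)
    rintro ⟨S, E⟩ ⟨hS, -⟩
    have hS' := hL S hS
    ext x
    have h3 : x⁻¹ ∈ S ↔ x ∈ S := by rw [← Set.mem_inv, hS']
    have h4 : x⁻¹ ∈ toggleSet E ↔ x ∈ toggleSet E := by rw [← Set.mem_inv, inv_toggleSet]
    simp only [Set.mem_inv, Set.mem_symmDiff, h3, h4]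
  have h3 : (L.ncard : ℝ) * 2 ^ (D.ncard : ℝ) ≤ 2 ^ c (Set.univ : Set R) := by
    rw [← ncard_inversionTransversal he, Real.rpow_natCast, Real.rpow_natCast]
    exact_mod_cast h2
  calc (L.ncard : ℝ) ≤ 2 ^ c (Set.univ : Set R) / 2 ^ (D.ncard : ℝ) :=
        (le_div_iff₀ (by positivity)).2 h3
    _ = 2 ^ (c (Set.univ : Set R) - D.ncard) := (Real.rpow_sub two_pos _ _).symm
    _ ≤ _ := by
      refine Real.rpow_le_rpow_of_exponent_le one_le_two ?_
      have h4 : ((tiedCosets K L).ncard : ℝ) ≤ 4 * D.ncard := by exact_mod_cast h1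
      linarith

end Cosets

/-! ### The action of the stabilizer on the quotient by the core -/

section Overgroup

variable {R : Type*} [Group R] (G : Subgroup (Equiv.Perm R)) (hG : rightRegular R ≤ G)

/-- The maps on `R/K` induced by the stabilizer of `1`. -/
def stabilizerMaps : Set (R ⧸ core G hG → R ⧸ core G hG) :=
  {f | ∃ h ∈ stabilizerImage G hG, ∀ q, f q = h • q}

theorem isStabilizerFamily_stabilizerMaps : IsStabilizerFamily (stabilizerMaps G hG) where
  map_one := by
    rintro f ⟨_, ⟨g, hg, rfl⟩, hf⟩
    rw [hf]
    exact (quotient_smul_mk G hG g 1).trans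
      (congrArg QuotientGroup.mk (MulAction.mem_stabilizer_iff.1 hg))
  exists_map_mul := by
    rintro f ⟨_, ⟨g, hg, rfl⟩, hf⟩ q
    obtain ⟨x, rfl⟩ := QuotientGroup.mk_surjective q
    -- Multiplying `g` on both sides by right translations gives `y ↦ g (y * x) * (g x)⁻¹`, which
    -- fixes 1.
    set g' : G := embed G hG (g • x) * g * embed G hG x⁻¹ with hg'
    have hsmul : ∀ y : R, g' • y = g • (y * x) * (g • x)⁻¹ := by
      intro y
      rw [hg', mul_smul, mul_smul]
      change (g • (y * x⁻¹⁻¹)) * (g • x)⁻¹ = _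
      rw [inv_inv]
    refine ⟨fun q => (QuotientGroup.mk g' : G ⧸ coreInG G hG) • q,
      ⟨_, ⟨g', ?_, rfl⟩, fun q => rfl⟩, fun q => ?_⟩
    · rw [SetLike.mem_coe, MulAction.mem_stabilizer_iff, hsmul, one_mul, mul_inv_cancel]
    · obtain ⟨y, rfl⟩ := QuotientGroup.mk_surjective q
      rw [hf, hf]
      change (QuotientGroup.mk (g • (y * x)) : R ⧸ core G hG) =
        QuotientGroup.mk (g' • y) * QuotientGroup.mk (g • x)
      rw [hsmul, ← QuotientGroup.mk_mul, inv_mul_cancel_right]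

theorem op_smul_core (x : R) :
    MulOpposite.op x • (core G hG : Set R) =
      (QuotientGroup.mk : R → R ⧸ core G hG) ⁻¹' {QuotientGroup.mk x} := by
  ext y
  rw [mem_rightCoset_iff, Set.mem_preimage, Set.mem_singleton_iff, eq_comm, QuotientGroup.eq,
    SetLike.mem_coe]
  exact (core_normal G hG).mem_comm_iff

theorem tied_smul {h : G ⧸ coreInG G hG} (hh : h ∈ stabilizerImage G hG)
    (q : R ⧸ core G hG) : Tied (core G hG) (evenSets G hG) q (h • q) := by
  intro S hS
  obtain ⟨x, rfl⟩ := QuotientGroup.mk_surjective q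
  obtain ⟨y, hy⟩ := QuotientGroup.mk_surjective (h • (QuotientGroup.mk x : R ⧸ core G hG))
  have key := hS.2 (QuotientGroup.mk x) x y
  rw [op_smul_core, op_smul_core, hy] at key
  refine key ?_ ?_ <;> refine Set.preimage_mono (Set.singleton_subset_iff.2 ?_)
  · exact MulAction.mem_orbit_self _
  · exact ⟨⟨h, hh⟩, rfl⟩

end Overgroup

end RegularOvergroup

theorem proposition3p7 {R : Type*} [Group R] [Finite R]
    (G : Subgroup (Equiv.Perm R))
    (hG : RegularOvergroup.rightRegular R < G)
    (hH : ∃ h ∈ RegularOvergroup.stabilizerImage G hG.le,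
      ∃ q : R ⧸ RegularOvergroup.core G hG.le, h • q ≠ q)
    (hab : ¬ RegularOvergroup.IsAbelianOfExponentGTTwo (R ⧸ RegularOvergroup.core G hG.le))
    (hdic : ¬ RegularOvergroup.IsGeneralizedDicyclic (R ⧸ RegularOvergroup.core G hG.le)) :
    ((RegularOvergroup.evenSets G hG.le).ncard : ℝ) ≤
      (2 : ℝ) ^ (RegularOvergroup.c (Set.univ : Set R) -
        (Nat.card (R ⧸ RegularOvergroup.core G hG.le) : ℝ) / 96) := by
  open RegularOvergroup in
  have hP := isStabilizerFamily_stabilizerMaps G hG.le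
  have hne : ∃ f ∈ stabilizerMaps G hG.le, ∃ q, f q ≠ q := by
    obtain ⟨h, hh, q, hq⟩ := hH
    exact ⟨fun q => h • q, ⟨h, hh, fun _ => rfl⟩, q, hq⟩
  have hY : Nat.card (R ⧸ core G hG.le) ≤
      24 * (invertedPoints (stabilizerMaps G hG.le))ᶜ.ncard := by
    by_contra! hlt
    exact (isAbelianOfExponentGTTwo_or_isGeneralizedDicyclic hP hne hlt).elim hab hdic
  have hsub : (invertedPoints (stabilizerMaps G hG.le))ᶜ ⊆
      tiedCosets (core G hG.le) (evenSets G hG.le) := by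
    intro q hq
    simp only [invertedPoints, Set.mem_compl_iff, Set.mem_ofPred_eq] at hq
    push Not at hq
    obtain ⟨f, ⟨h, hh, hf⟩, h1, h2⟩ := hq
    rw [hf] at h1 h2
    exact ⟨h • q, tied_smul G hG.le hh q, h1, h2⟩
  have hcard : Nat.card (R ⧸ core G hG.le) ≤
      24 * (tiedCosets (core G hG.le) (evenSets G hG.le)).ncard :=
    hY.trans (Nat.mul_le_mul_left _ (Set.ncard_le_ncard hsub (Set.toFinite _)))
  refine (ncard_le_two_rpow (K := core G hG.le) fun S hS => hS.1).trans ?_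
  refine Real.rpow_le_rpow_of_exponent_le one_le_two ?_
  -- The constant is 96 = 24 * 4: 24 from the inversion theorem, 4 from passing to dependent cosets.
  have h96 : (Nat.card (R ⧸ core G hG.le) : ℝ) ≤
      24 * (tiedCosets (core G hG.le) (evenSets G hG.le)).ncard := by exact_mod_cast hcard
  linarith
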